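/- Let $\mathcal H$ and $\mathcal G$ be real Hilbert spaces, and write $\mathscr Q_{\mathcal H}=\|\cdot\|_{\mathcal H}^2/2$ and $\mathscr Q_{\mathcal G}=\|\cdot\|_{\mathcal G}^2/2$. For an extended-real-valued function $f$, let $\operatorname{dom} f=\{x : f(x)<+\infty\}$ and let $f^*(u)=\sup_x(\langle x,u\rangle-f(x))$ be its conjugate; $f$ is proper if it takes its values in $]-\infty,+\infty]$ and $\operatorname{dom} f\neq\varnothing$. Let $(f_1\square f_2)(x)=\inf_z(f_1(z)+f_2(x-z))$ be the infimal convolution. For a bounded linear operator $T$, let $(T\cdot f)(y)=\inf\{f(x) : Tx=y\}$ (with $\inf\varnothing=+\infty$) be the infimal postcomposition of $f$ by $T$; it is called exact if for every $y\in T(\operatorname{dom} f)$ there is $x$ with $Tx=y$ and $(T\cdot f)(y)=f(x)\in{]-\infty,+\infty]}$. For a bounded linear operator $L\colon\mathcal H\to\mathcal G$ and $g\colon\mathcal G\to{]-\infty,+\infty]}$ proper, the proximal composition and the proximal cocomposition of $g$ with $L$ are $$L\triangleright g=\big((g^*\square\mathscr Q_{\mathcal G})\circ L\big)^*-\mathscr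 Q_{\mathcal H},\qquad L\triangleleft g=(L\triangleright g^*)^*.$$ **Proposition 5.3.** Suppose that $L\colon\mathcal H\to\mathcal G$ is a bounded linear operator with $0<\|L\|\le 1$, and let $g\colon\mathcal G\to{]-\infty,+\infty]}$ be a proper function that admits a continuous affine minorant. Then: 1. $L\triangleright g=L^*\cdot(g^{**}+\mathscr Q_{\mathcal G})-\mathscr Q_{\mathcal H}$, and the infimal postcomposition $L^*\cdot(g^{**}+\mathscr Q_{\mathcal G})$ is exact. 2. $\operatorname{dom}(L\triangleright g)=L^*(\operatorname{dom} g^{**})$. 3. $(L\triangleright g)^*=\big(\mathscr Q_{\mathcal H}-(g^*\square\mathscr Q_{\mathcal G})\circ L\big)^*-\mathscr Q_{\mathcal H}$. 4. $(L\triangleright g)^*=L\triangleleft g^*$. 5. $(L\triangleleft g)^*=L\triangleright g^*$. 6. $(L\triangleright g)\square\mathscr Q_{\mathcal H}+(L\triangleleft g^*)\square\mathscr Q_{\mathcal H}=\mathscr Q_{\mathcal H}$. 7. If $L$ is an isometry, then $L\triangleright g=L\triangleleft g$. -/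

import Mathlib

namespace ProxComposition

noncomputable section

variable {E F : Type*} [NormedAddCommGroup E] [InnerProductSpace ℝ E]
  [NormedAddCommGroup F] [InnerProductSpace ℝ F]

/-- The effective domain `{x | f x < +∞}` of an extended-real-valued function. -/
def effDom (f : E → EReal) : Set E := {x | f x < ⊤}

/-- `f` takes its values in `]-∞, +∞]` and is not identically `+∞`. -/
def IsProper (f : E → EReal) : Prop := (∀ x, f x ≠ ⊥) ∧ (effDom f).Nonempty

/-- `f` is bounded below by a continuous affine function. -/
def HasContinuousAffineMinorant (f : E → EReal) : Prop :=
  ∃ a : E →ᴬ[ℝ] ℝ, ∀ x, ((a x : ℝ) : EReal) ≤ f x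

/-- The canonical quadratic form `‖·‖² / 2`. -/
def quad (x : E) : EReal := ((‖x‖ ^ 2 / 2 : ℝ) : EReal)

/-- The conjugate `u ↦ sup_x (⟪x, u⟫ - f x)`. -/
def conj (f : E → EReal) (u : E) : EReal := ⨆ x : E, (((inner ℝ x u : ℝ) : EReal) - f x)

/-- The infimal convolution `x ↦ inf_z (f z + g (x - z))`. -/
def infConv (f g : E → EReal) (x : E) : EReal := ⨅ z : E, (f z + g (x - z))

/-- The infimal postcomposition `y ↦ inf {f x | T x = y}` of `f` by `T`
(the infimum of the empty set is `+∞`). -/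
def infPostcomp (T : E →L[ℝ] F) (f : E → EReal) (y : F) : EReal :=
  ⨅ (x : E) (_ : T x = y), f x

/-- Exactness of the infimal postcomposition: over every point of `T (dom f)` the infimum is
attained, with a value in `]-∞, +∞]`. -/
def IsExactPostcomp (T : E →L[ℝ] F) (f : E → EReal) : Prop :=
  ∀ y ∈ T '' effDom f, ∃ x : E, T x = y ∧ infPostcomp T f y = f x ∧ f x ≠ ⊥

/-- The proximal composition `((g* □ Q) ∘ L)* - Q`. -/
def proxComp (L : E →L[ℝ] F) (g : F → EReal) (x : E) : EReal :=
  conj (fun z : E => infConv (conj g) quad (L z)) x - quad x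

/-- The proximal cocomposition: the conjugate of the proximal composition of `g*` with `L`. -/
def proxCocomp (L : E →L[ℝ] F) (g : F → EReal) : E → EReal :=
  conj (proxComp L (conj g))

end

end ProxComposition

/-! Everything rests on proximal points of `g**`. Minimizing `g**` plus a strongly convex quadratic
has a solution because minimizing sequences are Cauchy, and its optimality condition is a
subgradient, that is, equality in Fenchel–Young for `g*` and `g**` (`exists_prox`). With the plain
quadratic this is Moreau's decomposition: the envelopes `e` of `g*` and `e'` of `g**` are finite,
have subgradients everywhere and satisfy `e + e' = Q`. As `‖L‖ ≤ 1`, `Q - e ∘ L = (Q - Q ∘ L) + e' ∘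
L` is convex too. Applying `(h* - Q)* = (Q - h)* - Q` to `h = e ∘ L`, then to `h = Q - e ∘ L`, gives
the conjugate of `L ▷ g` and shows that `L ▷ g` is its own biconjugate. The duality formulas, the
Moreau identity and the isometric case follow. Exactness comes from penalizing the constraint `L* y
= x`: the penalized minimizers converge strongly to a feasible point with the right value
(`exists_adjoint_eq_of_conj_le`). -/

namespace ProxComposition

open Filter Topology

/-! ### Proximal points over closed convex epigraphs. -/

section Polar

variable {E F : Type*} [NormedAddCommGroup E] [InnerProductSpace ℝ E]
  [NormedAddCommGroup F] [InnerProductSpace ℝ F]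

/-- The epigraph of the supremum of the affine functions `⟪x, ·⟫ - r`, `(x, r) ∈ S`. -/
def polarEpi (S : Set (E × ℝ)) : Set (E × ℝ) :=
  {p | ∀ q ∈ S, inner ℝ q.1 p.1 - q.2 ≤ p.2}

lemma polarEpi_segment {S : Set (E × ℝ)} {p q : E} {r ρ t : ℝ} (hp : (p, r) ∈ polarEpi S)
    (hq : (q, ρ) ∈ polarEpi S) (h0 : 0 ≤ t) (h1 : t ≤ 1) :
    (p + t • (q - p), r + t * (ρ - r)) ∈ polarEpi S := by
  intro x hx
  have h2 := hp x hx
  have h3 := hq x hx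
  simp only [inner_add_right, inner_smul_right, inner_sub_right] at *
  nlinarith [mul_le_mul_of_nonneg_left h3 h0, mul_le_mul_of_nonneg_left h2 (sub_nonneg.2 h1)]

lemma half_norm_sq_add_smul (a v : E) (t : ℝ) :
    ‖a + t • v‖ ^ 2 / 2 = ‖a‖ ^ 2 / 2 + t * inner ℝ a v + t ^ 2 * (‖v‖ ^ 2 / 2) := by
  rw [norm_add_sq_real, inner_smul_right, norm_smul, mul_pow, Real.norm_eq_abs, sq_abs]
  ring

/-- The quadratic `‖· - w‖² / 2 + ‖A · - b‖² / 2`. -/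
noncomputable def quadPen (A : E →L[ℝ] F) (w : E) (b : F) (y : E) : ℝ :=
  ‖y - w‖ ^ 2 / 2 + ‖A y - b‖ ^ 2 / 2

lemma quadPen_add_smul [CompleteSpace E] [CompleteSpace F] (A : E →L[ℝ] F) (w : E) (b : F)
    (p v : E) (t : ℝ) :
    quadPen A w b (p + t • v) = quadPen A w b p
      - t * inner ℝ (w - p - A.adjoint (A p - b)) v
      + t ^ 2 * (‖v‖ ^ 2 / 2 + ‖A v‖ ^ 2 / 2) := by
  have e1 : p + t • v - w = (p - w) + t • v := by abel
  have e2 : A (p + t • v) - b = (A p - b) + t • A v := by simp; abel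
  have e3 : inner ℝ (w - p - A.adjoint (A p - b)) v
      = - inner ℝ (p - w) v - inner ℝ (A p - b) (A v) := by
    rw [inner_sub_left, ContinuousLinearMap.adjoint_inner_left, ← neg_sub p w, inner_neg_left]
  rw [quadPen, e1, e2, half_norm_sq_add_smul, half_norm_sq_add_smul, e3, quadPen]
  ring

lemma quadPen_midpoint [CompleteSpace E] [CompleteSpace F] (A : E →L[ℝ] F) (w : E) (b : F)
    (p q : E) :
    quadPen A w b (p + (1 / 2 : ℝ) • (q - p)) + ‖q - p‖ ^ 2 / 8
      ≤ (quadPen A w b p + quadPen A w b q) / 2 := by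
  have h1 := quadPen_add_smul A w b p (q - p) (1 / 2)
  have h2 := quadPen_add_smul A w b p (q - p) 1
  rw [one_smul, add_sub_cancel] at h2
  rw [h1, h2]
  nlinarith [sq_nonneg ‖A (q - p)‖]

lemma neg_half_norm_sq_le (x v : E) : -(‖x‖ ^ 2 / 2) ≤ inner ℝ x v + ‖v‖ ^ 2 / 2 := by
  have := norm_add_sq_real x v
  nlinarith [sq_nonneg ‖x + v‖]

lemma cauchySeq_of_sq_le {X : Type*} [NormedAddCommGroup X] {y : ℕ → X} {C : ℝ}
    (h : ∀ n k, ‖y n - y k‖ ^ 2 ≤ C * (1 / ((n : ℝ) + 1) + 1 / ((k : ℝ) + 1))) :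
    CauchySeq y := by
  rw [Metric.cauchySeq_iff]
  intro ε hε
  have hlim : Tendsto (fun n : ℕ => |C| * (2 * (1 / ((n : ℝ) + 1)))) atTop (𝓝 0) := by
    simpa using (tendsto_one_div_add_atTop_nhds_zero_nat (𝕜 := ℝ)).const_mul 2 |>.const_mul |C|
  obtain ⟨N, hN⟩ := ((hlim.eventually (gt_mem_nhds (sq_pos_of_pos hε))).exists)
  refine ⟨N, fun m hm n hn => ?_⟩
  rw [dist_eq_norm]
  refine lt_of_pow_lt_pow_left₀ 2 hε.le (lt_of_le_of_lt (h m n) (lt_of_le_of_lt ?_ hN))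
  have h1 : 1 / ((m : ℝ) + 1) ≤ 1 / ((N : ℝ) + 1) :=
    one_div_le_one_div_of_le (by positivity) (by gcongr)
  have h2 : 1 / ((n : ℝ) + 1) ≤ 1 / ((N : ℝ) + 1) :=
    one_div_le_one_div_of_le (by positivity) (by gcongr)
  calc C * (1 / ((m : ℝ) + 1) + 1 / ((n : ℝ) + 1))
      ≤ |C| * (1 / ((m : ℝ) + 1) + 1 / ((n : ℝ) + 1)) := by gcongr; exact le_abs_self C
    _ ≤ _ := by gcongr; linarith

lemma exists_min_polarEpi [CompleteSpace E] [CompleteSpace F] {S : Set (E × ℝ)}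
    (hS : S.Nonempty) (hT : (polarEpi S).Nonempty) (A : E →L[ℝ] F) (w : E) (b : F) :
    ∃ p r, (p, r) ∈ polarEpi S ∧
      ∀ y ρ, (y, ρ) ∈ polarEpi S → r + quadPen A w b p ≤ ρ + quadPen A w b y := by
  set V : Set ℝ := (fun z : E × ℝ => z.2 + quadPen A w b z.1) '' polarEpi S with hV
  have hne : V.Nonempty := hT.image _
  have hbdd : BddBelow V := by
    obtain ⟨⟨x0, r0⟩, h0⟩ := hS
    refine ⟨inner ℝ x0 w - r0 - ‖x0‖ ^ 2 / 2, ?_⟩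
    rintro _ ⟨⟨y, ρ⟩, hy, rfl⟩
    have h1 := hy _ h0
    have h2 := neg_half_norm_sq_le x0 (y - w)
    simp only [inner_sub_right, quadPen] at *
    nlinarith [sq_nonneg ‖A y - b‖]
  have hle : ∀ y ρ, (y, ρ) ∈ polarEpi S → sInf V ≤ ρ + quadPen A w b y :=
    fun y ρ h => csInf_le hbdd ⟨(y, ρ), h, rfl⟩
  have hseq : ∀ n : ℕ, ∃ z ∈ polarEpi S, z.2 + quadPen A w b z.1 < sInf V + 1 / ((n : ℝ) + 1) := by
    intro n
    obtain ⟨_, ⟨z, hz, rfl⟩, h⟩ := exists_lt_of_csInf_lt hne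
      (lt_add_of_pos_right (sInf V) (by positivity : 0 < 1 / ((n : ℝ) + 1)))
    exact ⟨z, hz, h⟩
  choose z hz hzlt using hseq
  have hC : CauchySeq (fun n => (z n).1) := by
    -- The midpoint value is at least the infimum, so the gap `‖·‖² / 8` is at most half the sum of
    -- the two errors.
    refine cauchySeq_of_sq_le (C := 4) fun n k => ?_
    have h1 := hle _ _ (polarEpi_segment (hz k) (hz n) (by norm_num : (0 : ℝ) ≤ 1 / 2)
      (by norm_num))
    have h2 := quadPen_midpoint A w b (z k).1 (z n).1
    have h3 := hzlt n
    have h4 := hzlt k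
    linarith
  obtain ⟨p, hp⟩ := cauchySeq_tendsto_of_complete hC
  have hq : Tendsto (fun n => quadPen A w b (z n).1) atTop (𝓝 (quadPen A w b p)) := by
    have : Continuous (quadPen A w b) := by unfold quadPen; fun_prop
    exact (this.tendsto p).comp hp
  -- This height makes the infimum attained at `p`; the heights of the sequence need not converge.
  refine ⟨p, sInf V - quadPen A w b p, ?_, fun y ρ h => ?_⟩
  · intro x hx
    have hl : Tendsto (fun n => (inner ℝ x.1 (z n).1 : ℝ) - x.2) atTop
        (𝓝 (inner ℝ x.1 p - x.2)) := (tendsto_const_nhds.inner hp).sub_const _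
    have hr : Tendsto (fun n : ℕ => sInf V + 1 / ((n : ℝ) + 1) - quadPen A w b (z n).1) atTop
        (𝓝 (sInf V + 0 - quadPen A w b p)) :=
      (tendsto_one_div_add_atTop_nhds_zero_nat.const_add _).sub hq
    rw [add_zero] at hr
    refine le_of_tendsto_of_tendsto' hl hr fun n => ?_
    have h1 := hz n x hx
    have h2 := hzlt n
    linarith
  · rw [sub_add_cancel]
    exact hle y ρ h

lemma nonneg_of_forall_add_mul {a C : ℝ} (h : ∀ t : ℝ, 0 < t → t ≤ 1 → 0 ≤ a + t * C) :
    0 ≤ a := by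
  have hl : Tendsto (fun n : ℕ => a + 1 / ((n : ℝ) + 1) * C) atTop (𝓝 (a + 0 * C)) :=
    (tendsto_one_div_add_atTop_nhds_zero_nat.mul_const C).const_add a
  rw [zero_mul, add_zero] at hl
  refine ge_of_tendsto' hl fun n => h _ (by positivity) ?_
  rw [div_le_one (by positivity)]
  have : (0 : ℝ) ≤ n := n.cast_nonneg
  linarith

/-- A proximal point, together with the subgradient that its optimality condition yields. -/
lemma exists_prox_polarEpi [CompleteSpace E] [CompleteSpace F] {S : Set (E × ℝ)}
    (hS : S.Nonempty) (hT : (polarEpi S).Nonempty) (A : E →L[ℝ] F) (w : E) (b : F) :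
    ∃ p r, (p, r) ∈ polarEpi S ∧
      (w - p - A.adjoint (A p - b), inner ℝ p (w - p - A.adjoint (A p - b)) - r)
        ∈ polarEpi (polarEpi S) := by
  obtain ⟨p, r, hp, hmin⟩ := exists_min_polarEpi hS hT A w b
  refine ⟨p, r, hp, ?_⟩
  set s := w - p - A.adjoint (A p - b)
  rintro ⟨y, ρ⟩ hy
  -- First-order condition: compare with the segment towards `(y, ρ)`, divide by `t` and let `t`
  -- tend to 0.
  have key : 0 ≤ ρ - r - inner ℝ s (y - p) := by
    refine nonneg_of_forall_add_mul (C := ‖y - p‖ ^ 2 / 2 + ‖A (y - p)‖ ^ 2 / 2)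
      fun t h0 h1 => ?_
    have h2 := hmin _ _ (polarEpi_segment hp hy h0.le h1)
    rw [quadPen_add_smul] at h2
    refine nonneg_of_mul_nonneg_right (a := t) ?_ h0
    change _ ≤ _ + (_ - t * inner ℝ s (y - p) + _) at h2
    nlinarith
  simp only [inner_sub_right] at key ⊢
  rw [real_inner_comm s y, real_inner_comm s p]
  linarith

end Polar

/-! ### Conjugates through real upper bounds, and Moreau envelopes. -/

section Duality

variable {E F : Type*} [NormedAddCommGroup E] [InnerProductSpace ℝ E]
  [NormedAddCommGroup F] [InnerProductSpace ℝ F]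

lemma ereal_le_of_forall_real {a b : EReal} (h : ∀ c : ℝ, b ≤ c → a ≤ c) : a ≤ b :=
  EReal.le_of_forall_lt_iff_le.1 fun c hc => h c hc.le

lemma ereal_eq_of_forall_real {a b : EReal} (h : ∀ c : ℝ, a ≤ c ↔ b ≤ c) : a = b :=
  le_antisymm (ereal_le_of_forall_real fun c => (h c).2)
    (ereal_le_of_forall_real fun c => (h c).1)

lemma coe_sub_le_coe_iff {a c : ℝ} {b : EReal} :
    (a : EReal) - b ≤ c ↔ ∀ r : ℝ, b ≤ r → a - r ≤ c := by
  induction b with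
  | bot =>
    simp only [EReal.sub_bot (EReal.coe_ne_bot a), top_le_iff, EReal.coe_ne_top, bot_le,
      forall_true_left, false_iff, not_forall]
    exact ⟨a - c - 1, by linarith⟩
  | top => simp
  | coe b =>
    rw [← EReal.coe_sub, EReal.coe_le_coe_iff]
    refine ⟨fun h r hr => ?_, fun h => h b le_rfl⟩
    have := EReal.coe_le_coe_iff.1 hr
    linarith

lemma sub_coe_le_coe_iff {a : EReal} {b c : ℝ} : a - b ≤ c ↔ a ≤ ((c + b : ℝ) : EReal) := by
  rw [EReal.coe_add]
  exact EReal.sub_le_iff_le_add (Or.inl (EReal.coe_ne_bot _)) (Or.inl (EReal.coe_ne_top _))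

lemma add_coe_le_coe_iff {a : EReal} {b c : ℝ} : a + b ≤ c ↔ a ≤ ((c - b : ℝ) : EReal) := by
  rw [EReal.coe_sub]
  exact (EReal.le_sub_iff_add_le (Or.inl (EReal.coe_ne_bot _))
    (Or.inl (EReal.coe_ne_top _))).symm

/-- The epigraph of `f`. -/
def epi (f : E → EReal) : Set (E × ℝ) := {p | f p.1 ≤ p.2}

lemma conj_le_coe_iff {f : E → EReal} {u : E} {c : ℝ} :
    conj f u ≤ c ↔ ∀ (x : E) (r : ℝ), f x ≤ r → inner ℝ x u - r ≤ c := by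
  simp only [conj, iSup_le_iff, coe_sub_le_coe_iff]

lemma epi_conj (f : E → EReal) : epi (conj f) = polarEpi (epi f) := by
  ext ⟨u, c⟩
  exact conj_le_coe_iff.trans ⟨fun h q hq => h _ _ hq, fun h x r hx => h (x, r) hx⟩

lemma inner_le_of_conj_le {f : E → EReal} {x u : E} {r c : ℝ} (h : f x ≤ r)
    (h' : conj f u ≤ c) : inner ℝ x u ≤ r + c := by
  have := conj_le_coe_iff.1 h' x r h
  linarith

lemma conj_conj_le (f : E → EReal) (x : E) : conj (conj f) x ≤ f x := by
  refine ereal_le_of_forall_real fun c hc => conj_le_coe_iff.2 fun u r hu => ?_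
  have := inner_le_of_conj_le hc hu
  rw [real_inner_comm]
  linarith

lemma conj_anti {f g : E → EReal} (h : ∀ x, f x ≤ g x) (u : E) : conj g u ≤ conj f u :=
  ereal_le_of_forall_real fun _ hc => conj_le_coe_iff.2 fun x r hx =>
    conj_le_coe_iff.1 hc x r ((h x).trans hx)

lemma conj_conj_conj (f : E → EReal) : conj (conj (conj f)) = conj f :=
  funext fun u => le_antisymm (conj_conj_le _ u) (conj_anti (conj_conj_le f) u)

lemma ne_bot_of_conj_le {f : E → EReal} {u : E} {c : ℝ} (h : conj f u ≤ c) (x : E) :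
    f x ≠ ⊥ := by
  intro hx
  have := inner_le_of_conj_le (r := inner ℝ x u - c - 1) (hx.le.trans bot_le) h
  linarith

/-- The hypotheses say that `s` is a subgradient of `f` at `p`, so `p` is the proximal point of `p +
s` and attains the infimum. -/
lemma infConv_quad_eq {f : E → EReal} {p s : E} {r : ℝ} (hp : f p ≤ r)
    (hs : conj f s ≤ ((inner ℝ p s - r : ℝ) : EReal)) :
    infConv f quad (p + s) = ((r + ‖s‖ ^ 2 / 2 : ℝ) : EReal) := by
  apply le_antisymm
  · refine (iInf_le _ p).trans ?_
    rw [add_sub_cancel_left, EReal.coe_add]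
    exact add_le_add hp le_rfl
  · refine le_iInf fun z => ereal_le_of_forall_real fun c hc => ?_
    have h1 := inner_le_of_conj_le (add_coe_le_coe_iff.1 hc) hs
    have h2 : ‖p + s - z‖ ^ 2 = ‖(p - z) + s‖ ^ 2 := by congr 2; abel
    rw [h2, norm_add_sq_real, inner_sub_left] at h1
    rw [EReal.coe_le_coe_iff]
    nlinarith [sq_nonneg ‖p - z‖]

/-- Both `g*` and `g**` are finite somewhere. -/
def FiniteConj (g : E → EReal) : Prop :=
  (∃ (u : E) (c : ℝ), conj g u ≤ c) ∧ ∃ (y : E) (r : ℝ), conj (conj g) y ≤ r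

lemma FiniteConj.conj {g : E → EReal} (h : FiniteConj g) : FiniteConj (conj g) :=
  ⟨h.2, by rw [conj_conj_conj]; exact h.1⟩

lemma finiteConj_of_isProper [CompleteSpace E] {g : E → EReal} (hg : IsProper g)
    (hga : HasContinuousAffineMinorant g) : FiniteConj g := by
  obtain ⟨a, ha⟩ := hga
  obtain ⟨x, hx⟩ := hg.2
  refine ⟨⟨(InnerProductSpace.toDual ℝ E).symm a.contLinear, -a 0,
    conj_le_coe_iff.2 fun y r hy => ?_⟩, x, (g x).toReal,
    (conj_conj_le g x).trans (EReal.le_coe_toReal hx.ne)⟩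
  have h1 := EReal.coe_le_coe_iff.1 ((ha y).trans hy)
  have h2 := a.map_vadd 0 y
  simp only [vadd_eq_add, add_zero] at h2
  rw [real_inner_comm, InnerProductSpace.toDual_symm_apply]
  linarith

/-- The bipolar of `epi (conj g)` is the epigraph of `g*** = g*`, so the optimality condition bounds
`g*` itself. -/
lemma exists_prox [CompleteSpace E] [CompleteSpace F] {g : E → EReal} (hg : FiniteConj g)
    (A : E →L[ℝ] F) (w : E) (b : F) :
    ∃ (p s : E) (r : ℝ), s = w - p - A.adjoint (A p - b) ∧ conj (conj g) p ≤ r ∧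
      conj g s ≤ ((inner ℝ p s - r : ℝ) : EReal) := by
  obtain ⟨⟨u, c, hu⟩, y, ρ, hy⟩ := hg
  obtain ⟨p, r, h1, h2⟩ := exists_prox_polarEpi (S := epi (conj g)) ⟨(u, c), hu⟩
    (by rw [← epi_conj]; exact ⟨(y, ρ), hy⟩) A w b
  rw [← epi_conj] at h1 h2
  rw [← epi_conj, conj_conj_conj] at h2
  exact ⟨p, _, r, rfl, h1, h2⟩

/-- The Moreau decomposition: the envelopes of `g*` and `g**` are finite, they add up to `‖·‖²/2`,
and both have subgradients everywhere. -/
lemma exists_moreau_envelopes [CompleteSpace E] {g : E → EReal} (hg : FiniteConj g) :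
    ∃ e e' : E → ℝ, (∀ w, infConv (conj g) quad w = e w) ∧
      (∀ w, infConv (conj (conj g)) quad w = e' w) ∧ (∀ w, e w + e' w = ‖w‖ ^ 2 / 2) ∧
      (∀ w, ∃ p, ∀ v, e w + inner ℝ p (v - w) ≤ e v) ∧
      (∀ w, ∃ p, ∀ v, e' w + inner ℝ p (v - w) ≤ e' v) := by
  have hex : ∀ w, ∃ (p s : E) (r : ℝ), p + s = w ∧ conj (conj g) p ≤ r ∧
      conj g s ≤ ((inner ℝ p s - r : ℝ) : EReal) := by
    intro w
    -- Without the penalty term, the residual is `s = w - p`.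
    obtain ⟨p, s, r, hs, h1, h2⟩ := exists_prox hg (0 : E →L[ℝ] E) w 0
    exact ⟨p, s, r, by rw [hs]; simp, h1, h2⟩
  choose p s r hw hp hs using hex
  have young : ∀ w v, inner ℝ (p w) (s v) ≤ r w + (inner ℝ (p v) (s v) - r v) := fun w v => by
    have := inner_le_of_conj_le (hs v) (hp w)
    rw [real_inner_comm] at this
    linarith
  refine ⟨fun w => inner ℝ (p w) (s w) - r w + ‖p w‖ ^ 2 / 2, fun w => r w + ‖s w‖ ^ 2 / 2,
    fun w => ?_, fun w => ?_, fun w => ?_, fun w => ⟨p w, fun v => ?_⟩,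
    fun w => ⟨s w, fun v => ?_⟩⟩
  · have := infConv_quad_eq (p := s w) (s := p w) (hs w)
      (by rw [real_inner_comm, sub_sub_cancel]; exact hp w)
    rwa [add_comm, hw] at this
  · have := infConv_quad_eq (p := p w) (s := s w) (hp w) (by rw [conj_conj_conj]; exact hs w)
    rwa [hw] at this
  · have h1 := norm_add_sq_real (p w) (s w)
    rw [hw] at h1
    simp only [h1]
    ring
  · have h1 := young w v
    have h2 := norm_sub_sq_real (p v) (p w)
    have h3 : v - w = (p v + s v) - (p w + s w) := by rw [hw, hw]
    rw [h3]
    simp only [inner_sub_right, inner_add_right, real_inner_self_eq_norm_sq]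
    rw [real_inner_comm] at h2
    nlinarith [sq_nonneg ‖p v - p w‖]
  · have h1 := young v w
    have h2 := norm_sub_sq_real (s v) (s w)
    have h3 : v - w = (p v + s v) - (p w + s w) := by rw [hw, hw]
    rw [h3]
    simp only [inner_sub_right, inner_add_right, real_inner_self_eq_norm_sq]
    rw [real_inner_comm] at h2
    rw [real_inner_comm (p v), real_inner_comm (p w)]
    nlinarith [sq_nonneg ‖s v - s w‖]

lemma conj_le_of_subgradient {h : E → ℝ} {z u : E}
    (hu : ∀ v, h z + inner ℝ u (v - z) ≤ h v) :
    conj (fun x => (h x : EReal)) u ≤ ((inner ℝ z u - h z : ℝ) : EReal) := by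
  refine conj_le_coe_iff.2 fun x r hx => ?_
  have h1 := hu x
  have h2 := EReal.coe_le_coe_iff.1 hx
  rw [inner_sub_right] at h1
  rw [real_inner_comm u x, real_inner_comm u z]
  linarith

lemma conj_conj_of_subgradients {h : E → ℝ}
    (hu : ∀ z, ∃ u, ∀ v, h z + inner ℝ u (v - z) ≤ h v) :
    conj (conj fun x => (h x : EReal)) = fun x => (h x : EReal) := by
  funext z
  refine le_antisymm (conj_conj_le _ z) (ereal_le_of_forall_real fun c hc => ?_)
  obtain ⟨u, hu⟩ := hu z
  have := inner_le_of_conj_le (conj_le_of_subgradient hu) hc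
  rw [real_inner_comm] at this
  rw [EReal.coe_le_coe_iff]
  linarith

/-- Conjugation of the difference with the canonical quadratic form. -/
lemma conj_conj_sub_quad {h : E → ℝ}
    (hh : conj (conj fun x => (h x : EReal)) = fun x => (h x : EReal)) (u : E) :
    conj (fun x => conj (fun x => (h x : EReal)) x - quad x) u =
      conj (fun x => ((‖x‖ ^ 2 / 2 - h x : ℝ) : EReal)) u - quad u := by
  refine ereal_eq_of_forall_real fun c => ?_
  rw [quad, sub_coe_le_coe_iff, conj_le_coe_iff, conj_le_coe_iff]
  constructor
  · intro H x r hr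
    -- Since `h = h**`, a bound on `h x` may be proved on the biconjugate; the constant comes from
    -- `‖u + v - x‖² ≥ 0`.
    have h1 : conj (conj fun x => (h x : EReal)) x
        ≤ ((c + ‖u‖ ^ 2 / 2 - inner ℝ x u + ‖x‖ ^ 2 / 2 : ℝ) : EReal) := by
      refine conj_le_coe_iff.2 fun v ρ hv => ?_
      have h2 := H v (ρ - ‖v‖ ^ 2 / 2) (by
        rw [quad, sub_coe_le_coe_iff, sub_add_cancel]; exact hv)
      have h3 := norm_sub_sq_real (u + v) x
      rw [norm_add_sq_real, inner_add_left] at h3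
      rw [real_inner_comm u x]
      rw [real_inner_comm] at h2
      nlinarith [sq_nonneg ‖u + v - x‖]
    rw [hh, EReal.coe_le_coe_iff] at h1
    have := EReal.coe_le_coe_iff.1 hr
    linarith
  · intro H v r hr
    rw [quad, sub_coe_le_coe_iff] at hr
    -- The point where the square `‖u + v - x‖²` vanishes.
    have h1 := H (u + v) _ le_rfl
    have h2 := inner_le_of_conj_le (f := fun x => (h x : EReal)) (x := u + v) le_rfl hr
    rw [norm_add_sq_real] at h1
    simp only [inner_add_left, real_inner_self_eq_norm_sq] at h1 h2
    linarith [real_inner_comm u v]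

end Duality

/-! ### Exactness, conjugates of the proximal composition, and the isometric case. -/

section Main

variable {H G : Type*} [NormedAddCommGroup H] [InnerProductSpace ℝ H] [CompleteSpace H]
  [NormedAddCommGroup G] [InnerProductSpace ℝ G] [CompleteSpace G]

lemma cauchySeq_of_sq_le_sub {X : Type*} [NormedAddCommGroup X] {y : ℕ → X} {M : ℕ → ℝ} {c : ℝ}
    (hc : ∀ n, M n ≤ c) (h : ∀ n k, n ≤ k → M n + ‖y k - y n‖ ^ 2 / 2 ≤ M k) :
    CauchySeq y := by
  have hmono : Monotone M := fun n k hnk => by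
    have := h n k hnk
    nlinarith [sq_nonneg ‖y k - y n‖]
  have hC := (tendsto_atTop_ciSup hmono ⟨c, by rintro _ ⟨n, rfl⟩; exact hc n⟩).cauchySeq
  rw [Metric.cauchySeq_iff'] at hC ⊢
  intro ε hε
  obtain ⟨N, hN⟩ := hC (ε ^ 2 / 2) (by positivity)
  refine ⟨N, fun n hn => ?_⟩
  have h1 := hN n hn
  rw [Real.dist_eq] at h1
  have h2 := h N n hn
  have h3 := le_abs_self (M n - M N)
  rw [dist_eq_norm]
  exact lt_of_pow_lt_pow_left₀ 2 hε.le (by linarith)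

/-- If the conjugate of `(g* □ Q) ∘ L` is at most `c` at `x`, then some `y` with `L* y = x`
satisfies `(g** + Q) y ≤ c`. -/
lemma exists_adjoint_eq_of_conj_le (L : H →L[ℝ] G) {g : G → EReal} (hg : FiniteConj g)
    {x : H} {c : ℝ} (hx : conj (fun z => infConv (conj g) quad (L z)) x ≤ c) :
    ∃ y, L.adjoint y = x ∧ conj (conj g) y ≤ ((c - ‖y‖ ^ 2 / 2 : ℝ) : EReal) := by
  have hex : ∀ n : ℕ, ∃ (p s : G) (r : ℝ),
      s = -p - L (((n : ℝ) + 1) • (L.adjoint p - x)) ∧ conj (conj g) p ≤ r ∧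
        conj g s ≤ ((inner ℝ p s - r : ℝ) : EReal) := by
    intro n
    -- The square roots make the penalty `(n + 1) / 2 * ‖L* y - x‖²`.
    obtain ⟨p, s, r, hs, h1, h2⟩ := exists_prox hg (√((n : ℝ) + 1) • L.adjoint) 0
      (√((n : ℝ) + 1) • x)
    refine ⟨p, s, r, ?_, h1, h2⟩
    rw [hs, zero_sub, smul_apply, ← smul_sub, map_smul, map_smulₛₗ]
    simp only [conj_trivial, smul_apply, map_smul, smul_smul,
      ContinuousLinearMap.adjoint_adjoint]
    rw [Real.mul_self_sqrt (by positivity)]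
  choose y s r hs hy hys using hex
  have inner_s : ∀ n v, inner ℝ v (s n) = -inner ℝ v (y n)
      - ((n : ℝ) + 1) * inner ℝ (L.adjoint v) (L.adjoint (y n) - x) := fun n v => by
    rw [hs, inner_sub_right, inner_neg_right, ← ContinuousLinearMap.adjoint_inner_left,
      inner_smul_right]
  have bound : ∀ n, r n + ‖y n‖ ^ 2 / 2 + ((n : ℝ) + 1) * ‖L.adjoint (y n) - x‖ ^ 2 ≤ c := by
    intro n
    have h1 := infConv_quad_eq (p := s n) (s := y n) (hys n)
      (by rw [real_inner_comm, sub_sub_cancel]; exact hy n)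
    -- Optimality puts `s n + y n` in the range of `L`, where the envelope is known exactly and `hx`
    -- can be tested.
    have h2 : s n + y n = L (-(((n : ℝ) + 1) • (L.adjoint (y n) - x))) := by
      rw [hs, map_neg]; abel
    rw [h2] at h1
    have h3 := conj_le_coe_iff.1 hx _ _ h1.le
    have h5 := real_inner_self_eq_norm_sq (L.adjoint (y n) - x)
    rw [inner_sub_left] at h5
    rw [inner_s, real_inner_self_eq_norm_sq, inner_neg_left, inner_smul_left, conj_trivial,
      real_inner_comm x] at h3
    rw [← h5]
    linarith
  have hC : CauchySeq y := by
    -- `M n` is the `n`-th penalized minimum. Strong convexity at `y n`, tested at `y k`, gives the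
    -- gap; raising the penalty from `n` to `k` only increases the value.
    refine cauchySeq_of_sq_le_sub (c := c)
      (M := fun n => r n + ‖y n‖ ^ 2 / 2 + ((n : ℝ) + 1) / 2 * ‖L.adjoint (y n) - x‖ ^ 2)
      (fun n => ?_) fun n k hnk => ?_
    · have h1 := bound n
      have h2 : 0 ≤ ((n : ℝ) + 1) * ‖L.adjoint (y n) - x‖ ^ 2 := by positivity
      linarith
    · have h1 := inner_le_of_conj_le (hys n) (hy k)
      rw [real_inner_comm, inner_s, inner_s, real_inner_self_eq_norm_sq] at h1
      have h2 := norm_sub_sq_real (y k) (y n)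
      have h3 : (n : ℝ) ≤ k := by exact_mod_cast hnk
      have h4 : ((n : ℝ) + 1) / 2 * ‖L.adjoint (y k) - x‖ ^ 2
          ≤ ((k : ℝ) + 1) / 2 * ‖L.adjoint (y k) - x‖ ^ 2 := by gcongr
      have h5 : inner ℝ (L.adjoint (y n)) (L.adjoint (y n) - x)
          - inner ℝ (L.adjoint (y k)) (L.adjoint (y n) - x)
          = ‖L.adjoint (y n) - x‖ ^ 2
            - inner ℝ (L.adjoint (y k) - x) (L.adjoint (y n) - x) := by
        rw [← real_inner_self_eq_norm_sq, ← inner_sub_left, ← inner_sub_left]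
        congr 1
        abel
      have h6 := norm_sub_sq_real (L.adjoint (y k) - x) (L.adjoint (y n) - x)
      have h7 : 0 ≤ ((n : ℝ) + 1) / 2
          * ‖(L.adjoint (y k) - x) - (L.adjoint (y n) - x)‖ ^ 2 := by positivity
      rw [h6] at h7
      have h8 := congrArg (fun t => ((n : ℝ) + 1) * t) h5
      linarith
  obtain ⟨p, hp⟩ := cauchySeq_tendsto_of_complete hC
  obtain ⟨u, d, hu⟩ := hg.1
  have lower : ∀ n, -(d + ‖u‖ ^ 2 / 2) ≤ r n + ‖y n‖ ^ 2 / 2 := fun n => by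
    have h1 := inner_le_of_conj_le hu (hy n)
    have h2 := neg_half_norm_sq_le u (y n)
    linarith
  refine ⟨p, ?_, conj_le_coe_iff.2 fun v ρ hv => ?_⟩
  · have hl : Tendsto (fun n => ‖L.adjoint (y n) - x‖ ^ 2) atTop
        (𝓝 (‖L.adjoint p - x‖ ^ 2)) :=
      (((L.adjoint.continuous.tendsto p).comp hp).sub_const x).norm.pow 2
    have hr : Tendsto (fun n : ℕ => (c + (d + ‖u‖ ^ 2 / 2)) * (1 / ((n : ℝ) + 1))) atTop
        (𝓝 ((c + (d + ‖u‖ ^ 2 / 2)) * 0)) :=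
      tendsto_one_div_add_atTop_nhds_zero_nat.const_mul _
    have h1 := le_of_tendsto_of_tendsto' hl hr fun n => by
      rw [mul_one_div, le_div_iff₀ (by positivity), mul_comm]
      linarith [lower n, bound n]
    rw [mul_zero] at h1
    exact sub_eq_zero.1 (norm_eq_zero.1 (pow_eq_zero_iff two_ne_zero |>.1
      (le_antisymm h1 (by positivity))))
  · have hl : Tendsto (fun n => (inner ℝ v (y n) : ℝ) - ρ) atTop (𝓝 (inner ℝ v p - ρ)) :=
      (tendsto_const_nhds.inner hp).sub_const _
    have hr : Tendsto (fun n => c - ‖y n‖ ^ 2 / 2) atTop (𝓝 (c - ‖p‖ ^ 2 / 2)) :=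
      ((hp.norm.pow 2).div_const 2).const_sub c
    refine le_of_tendsto_of_tendsto' hl hr fun n => ?_
    have h1 := inner_le_of_conj_le hv (hy n)
    have h2 : 0 ≤ ((n : ℝ) + 1) * ‖L.adjoint (y n) - x‖ ^ 2 := by positivity
    linarith [bound n]

lemma conj_envelope_comp_le (L : H →L[ℝ] G) {g : G → EReal} {y : G} {c : ℝ}
    (hy : conj (conj g) y ≤ ((c - ‖y‖ ^ 2 / 2 : ℝ) : EReal)) :
    conj (fun z => infConv (conj g) quad (L z)) (L.adjoint y) ≤ c := by
  refine conj_le_coe_iff.2 fun z r hz => ?_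
  rw [ContinuousLinearMap.adjoint_inner_right]
  have : ((inner ℝ (L z) y - c : ℝ) : EReal) ≤ infConv (conj g) quad (L z) := by
    refine le_iInf fun v => ereal_le_of_forall_real fun ρ hρ => ?_
    have h1 := inner_le_of_conj_le (add_coe_le_coe_iff.1 hρ) hy
    have h2 := neg_half_norm_sq_le (-y) (L z - v)
    rw [norm_neg, inner_neg_left, inner_sub_right, real_inner_comm v, real_inner_comm (L z)] at h2
    rw [real_inner_comm] at h1
    rw [EReal.coe_le_coe_iff]
    linarith [real_inner_comm v y, real_inner_comm (L z) y]
  have := EReal.coe_le_coe_iff.1 (this.trans hz)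
  linarith

lemma conj_envelope_comp_eq_infPostcomp (L : H →L[ℝ] G) {g : G → EReal} (hg : FiniteConj g)
    (x : H) :
    conj (fun z => infConv (conj g) quad (L z)) x =
      infPostcomp L.adjoint (fun y => conj (conj g) y + quad y) x := by
  apply le_antisymm
  · refine le_iInf₂ fun y hy => ereal_le_of_forall_real fun c hc => ?_
    rw [← hy]
    exact conj_envelope_comp_le L (add_coe_le_coe_iff.1 hc)
  · refine ereal_le_of_forall_real fun c hc => ?_
    obtain ⟨y, hy, hyc⟩ := exists_adjoint_eq_of_conj_le L hg hc
    exact (iInf₂_le y hy).trans (add_coe_le_coe_iff.2 hyc)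

lemma conj_conj_add_quad_ne_bot {X : Type*} [NormedAddCommGroup X] [InnerProductSpace ℝ X]
    {g : X → EReal} (hg : FiniteConj g) (y : X) :
    conj (conj g) y + quad y ≠ ⊥ := by
  obtain ⟨u, c, hu⟩ := hg.1
  rw [← conj_conj_conj] at hu
  exact EReal.add_ne_bot_iff.2 ⟨ne_bot_of_conj_le hu y, EReal.coe_ne_bot _⟩

lemma isExactPostcomp_adjoint (L : H →L[ℝ] G) {g : G → EReal} (hg : FiniteConj g) :
    IsExactPostcomp L.adjoint (fun y => conj (conj g) y + quad y) := by
  rintro _ ⟨y, hy, rfl⟩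
  set k : G → EReal := fun y => conj (conj g) y + quad y with hk
  have hle : infPostcomp L.adjoint k (L.adjoint y) ≤ k y :=
    iInf₂_le (f := fun (v : G) (_ : L.adjoint v = L.adjoint y) => k v) y rfl
  obtain ⟨u, c, hu⟩ := hg.1
  have hbot : infPostcomp L.adjoint k (L.adjoint y) ≠ ⊥ := by
    have : ((-(c + ‖u‖ ^ 2 / 2) : ℝ) : EReal) ≤ infPostcomp L.adjoint k (L.adjoint y) := by
      refine le_iInf₂ fun v _ => ereal_le_of_forall_real fun ρ hρ => ?_
      have h1 := inner_le_of_conj_le hu (add_coe_le_coe_iff.1 hρ)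
      have h2 := neg_half_norm_sq_le u v
      rw [EReal.coe_le_coe_iff]
      linarith
    exact fun h => absurd (this.trans h.le) (by simp)
  obtain ⟨v, hv, hvc⟩ := exists_adjoint_eq_of_conj_le L hg (x := L.adjoint y)
    (c := (infPostcomp L.adjoint k (L.adjoint y)).toReal) (by
      rw [conj_envelope_comp_eq_infPostcomp L hg]
      exact EReal.le_coe_toReal (hle.trans_lt hy).ne)
  refine ⟨v, hv, le_antisymm (iInf₂_le v hv) ?_, conj_conj_add_quad_ne_bot hg v⟩
  have h1 := add_coe_le_coe_iff.2 hvc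
  rwa [EReal.coe_toReal (hle.trans_lt hy).ne hbot] at h1

lemma effDom_proxComp (L : H →L[ℝ] G) {g : G → EReal} (hg : FiniteConj g) :
    effDom (proxComp L g) = L.adjoint '' effDom (conj (conj g)) := by
  ext x
  constructor
  · intro hx
    have h1 := sub_coe_le_coe_iff.1 (EReal.le_coe_toReal (x := proxComp L g x) (ne_of_lt hx))
    obtain ⟨y, hy, hyc⟩ := exists_adjoint_eq_of_conj_le L hg h1
    exact ⟨y, hyc.trans_lt (EReal.coe_lt_top _), hy⟩
  · rintro ⟨y, hy, rfl⟩
    have h1 := conj_envelope_comp_le L (g := g) (y := y)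
      (c := (conj (conj g) y).toReal + ‖y‖ ^ 2 / 2) (by
        rw [add_sub_cancel_right]; exact EReal.le_coe_toReal (ne_of_lt hy))
    have h2 : proxComp L g (L.adjoint y) ≤ (((conj (conj g) y).toReal + ‖y‖ ^ 2 / 2
        - ‖L.adjoint y‖ ^ 2 / 2 : ℝ) : EReal) :=
      sub_coe_le_coe_iff.2 (by rw [sub_add_cancel]; exact h1)
    exact h2.trans_lt (EReal.coe_lt_top _)

/-- Conjugates of `L ▷ g`, for a nonexpansive `L`. -/
lemma conj_proxComp (L : H →L[ℝ] G) (hL : ‖L‖ ≤ 1) {g : G → EReal} (hg : FiniteConj g) :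
    (∀ u, conj (proxComp L g) u =
      conj (fun x => quad x - infConv (conj g) quad (L x)) u - quad u) ∧
    conj (conj (proxComp L g)) = proxComp L g ∧ FiniteConj (proxComp L g) := by
  obtain ⟨e, e', he, he', hadd, hsub, hsub'⟩ := exists_moreau_envelopes hg
  set φ : H → ℝ := fun x => ‖x‖ ^ 2 / 2 - e (L x) with hφ
  have hs : ∀ z, ∃ u, ∀ v, e (L z) + inner ℝ u (v - z) ≤ e (L v) := by
    intro z
    obtain ⟨p, hp⟩ := hsub (L z)
    refine ⟨L.adjoint p, fun v => ?_⟩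
    rw [ContinuousLinearMap.adjoint_inner_left, map_sub]
    exact hp _
  have hsφ : ∀ z, ∃ u, ∀ v, φ z + inner ℝ u (v - z) ≤ φ v := by
    intro z
    obtain ⟨p, hp⟩ := hsub' (L z)
    -- The gradient of `Q - Q ∘ L`, convex since `‖L‖ ≤ 1`, plus a subgradient of `e' ∘ L`.
    refine ⟨z - L.adjoint (L z) + L.adjoint p, fun v => ?_⟩
    have h1 := hp (L v)
    have h2 := hadd (L z)
    have h3 := hadd (L v)
    have h4 : ‖L (v - z)‖ ^ 2 ≤ ‖v - z‖ ^ 2 := by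
      gcongr
      exact (L.le_of_opNorm_le hL _).trans_eq (one_mul _)
    rw [map_sub, norm_sub_sq_real, norm_sub_sq_real] at h4
    rw [inner_add_left, inner_sub_left, ContinuousLinearMap.adjoint_inner_left,
      ContinuousLinearMap.adjoint_inner_left, map_sub]
    simp only [inner_sub_right, real_inner_self_eq_norm_sq, hφ] at *
    linarith [real_inner_comm v z, real_inner_comm (L v) (L z)]
  have hcomp : (fun z => infConv (conj g) quad (L z)) = fun z => (e (L z) : EReal) :=
    funext fun z => he _
  have hφe : (fun x => quad x - infConv (conj g) quad (L x)) = fun x => (φ x : EReal) := by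
    funext x
    rw [he, quad, hφ, EReal.coe_sub]
  have hprox : proxComp L g = fun x => conj (fun z => (e (L z) : EReal)) x - quad x := by
    funext x
    rw [proxComp, hcomp]
  have h1 : ∀ u, conj (proxComp L g) u = conj (fun x => (φ x : EReal)) u - quad u := by
    rw [hprox]
    exact conj_conj_sub_quad (conj_conj_of_subgradients hs)
  have h2 : conj (conj (proxComp L g)) = proxComp L g := by
    rw [funext h1, hprox]
    funext u
    rw [conj_conj_sub_quad (conj_conj_of_subgradients hsφ)]
    simp only [hφ, sub_sub_cancel]
  refine ⟨by rw [hφe]; exact h1, h2, ?_, ?_⟩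
  · obtain ⟨u, hu⟩ := hsφ 0
    refine ⟨u, inner ℝ 0 u - φ 0 - ‖u‖ ^ 2 / 2, ?_⟩
    rw [h1, quad, sub_coe_le_coe_iff, sub_add_cancel]
    exact conj_le_of_subgradient hu
  · obtain ⟨u, hu⟩ := hs 0
    refine ⟨u, inner ℝ 0 u - e (L 0) - ‖u‖ ^ 2 / 2, ?_⟩
    rw [h2, hprox]
    refine sub_coe_le_coe_iff.2 ?_
    rw [sub_add_cancel]
    exact conj_le_of_subgradient (h := fun z => e (L z)) hu

lemma proxCocomp_conj {X Y : Type*} [NormedAddCommGroup X] [InnerProductSpace ℝ X]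
    [NormedAddCommGroup Y] [InnerProductSpace ℝ Y] (L : X →L[ℝ] Y) (g : Y → EReal) :
    proxCocomp L (conj g) = conj (proxComp L g) := by
  have : proxComp L (conj (conj g)) = proxComp L g := by
    unfold proxComp
    rw [conj_conj_conj]
  rw [proxCocomp, this]

lemma infConv_quad_add_infConv_conj_quad {f : H → EReal} (hf : FiniteConj f)
    (hff : conj (conj f) = f) (x : H) :
    infConv f quad x + infConv (conj f) quad x = quad x := by
  obtain ⟨e, e', he, he', hadd, -, -⟩ := exists_moreau_envelopes hf
  rw [hff] at he'
  rw [he, he', quad, ← EReal.coe_add, ← hadd, add_comm]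

lemma proxComp_eq_proxCocomp_of_isometry (L : H →L[ℝ] G) (hL : Isometry L) {g : G → EReal}
    (hg : FiniteConj g) : proxComp L g = proxCocomp L g := by
  have hn : ∀ x, ‖L x‖ = ‖x‖ := (AddMonoidHomClass.isometry_iff_norm L).1 hL
  have hL1 : ‖L‖ ≤ 1 := L.opNorm_le_bound zero_le_one fun x => by rw [hn, one_mul]
  funext u
  rw [proxCocomp, (conj_proxComp L hL1 hg.conj).1 u, proxComp]
  congr 3
  funext x
  obtain ⟨e, e', he, he', hadd, -, -⟩ := exists_moreau_envelopes hg
  -- For an isometry `Q = Q ∘ L`, hence `Q - e' ∘ L = e ∘ L`.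
  rw [he, he', quad, ← hn, ← hadd, ← EReal.coe_sub, add_sub_cancel_right]

end Main

end ProxComposition

theorem proposition5p3 {H G : Type*}
    [NormedAddCommGroup H] [InnerProductSpace ℝ H] [CompleteSpace H]
    [NormedAddCommGroup G] [InnerProductSpace ℝ G] [CompleteSpace G]
    (L : H →L[ℝ] G) (hL0 : 0 < ‖L‖) (hL1 : ‖L‖ ≤ 1)
    (g : G → EReal) (hg : ProxComposition.IsProper g)
    (hga : ProxComposition.HasContinuousAffineMinorant g) :
    -- L ▷ g is the exact postcomposition of g** + Q_G by L*, minus Q_H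
    ((∀ x : H, ProxComposition.proxComp L g x =
        ProxComposition.infPostcomp L.adjoint
          (fun y => ProxComposition.conj (ProxComposition.conj g) y + ProxComposition.quad y) x
        - ProxComposition.quad x) ∧
      ProxComposition.IsExactPostcomp L.adjoint
        (fun y => ProxComposition.conj (ProxComposition.conj g) y + ProxComposition.quad y)) ∧
    -- domain
    ProxComposition.effDom (ProxComposition.proxComp L g) =
      L.adjoint '' ProxComposition.effDom (ProxComposition.conj (ProxComposition.conj g)) ∧
    -- (L ▷ g)* = (Q_H - (g* □ Q_G) ∘ L)* - Q_H
    (∀ u : H, ProxComposition.conj (ProxComposition.proxComp L g) u =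
      ProxComposition.conj (fun x : H => ProxComposition.quad x -
        ProxComposition.infConv (ProxComposition.conj g) ProxComposition.quad (L x)) u
      - ProxComposition.quad u) ∧
    -- (L ▷ g)* = L ◁ g*
    ProxComposition.conj (ProxComposition.proxComp L g) =
      ProxComposition.proxCocomp L (ProxComposition.conj g) ∧
    -- (L ◁ g)* = L ▷ g*
    ProxComposition.conj (ProxComposition.proxCocomp L g) =
      ProxComposition.proxComp L (ProxComposition.conj g) ∧
    -- (L ▷ g) □ Q_H + (L ◁ g*) □ Q_H = Q_H
    (∀ x : H, ProxComposition.infConv (ProxComposition.proxComp L g) ProxComposition.quad x +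
      ProxComposition.infConv (ProxComposition.proxCocomp L (ProxComposition.conj g))
        ProxComposition.quad x = ProxComposition.quad x) ∧
    -- the isometric case
    (Isometry L → ProxComposition.proxComp L g = ProxComposition.proxCocomp L g) := by
  have hf := ProxComposition.finiteConj_of_isProper hg hga
  obtain ⟨hconj, hcc, hfin⟩ := ProxComposition.conj_proxComp L hL1 hf
  refine ⟨⟨fun x => ?_, ProxComposition.isExactPostcomp_adjoint L hf⟩,
    ProxComposition.effDom_proxComp L hf, hconj, (ProxComposition.proxCocomp_conj L g).symm,
    (ProxComposition.conj_proxComp L hL1 hf.conj).2.1, fun x => ?_,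
    fun h => ProxComposition.proxComp_eq_proxCocomp_of_isometry L h hf⟩
  · rw [← ProxComposition.conj_envelope_comp_eq_infPostcomp L hf]
    rfl
  · rw [ProxComposition.proxCocomp_conj]
    exact ProxComposition.infConv_quad_add_infConv_conj_quad hfin hcc x
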